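/- Let $K\ge 1$, $1\le r\le 2K$, $\alpha>2$, $\lambda_b>0$, $P>0$, $\rho_I\ge 0$, $\sigma^2>0$, $c=5/4$, and let ${\bf u}\in\mathbb C^N$ be a nonzero receive filter. Put $$\sigma_{\tilde k}^2=\sigma^2\|{\bf u}\|^2,\qquad \omega_{\tilde k}=\Gamma\!\left(1-\tfrac2\alpha\right)\left(\tfrac{\rho_I}{P}\,|{\bf u}^{\rm H}{\bf 1}_N|^2\right)^{2/\alpha},\qquad \ell(x)=x^{-\alpha}.$$ Let the distances of $2K$ users from their serving base station be independent and identically distributed with density $f_d(x)=2c\lambda_b\pi x\,e^{-c\lambda_b\pi x^2}$, $x\ge 0$. Under distance-based grouping the users are ranked in increasing order of distance; let $d_{\tilde k}$ be the distance of the user $\tilde k$ of rank $r_{\tilde k}=r$, i.e. the $r$-th smallest of the $2K$ distances. For complex $s$ with $\operatorname{Re}s>0$ (principal branches of powers) let $$\varphi_{\tilde k}(s)=\mathbb E_{d_{\tilde k}}\left\{\exp\left(-\frac{\sigma_{\tilde k}^2}{P\,\ell(d_{\tilde k})}\,s-\pi\lambda_b\,\omega_{\tilde k}\,d_{\tilde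 k}^2\,s^{2/\alpha}\right)\right\}.$$ Let $H^{1,1}_{1,1}$ be Fox's H-function $$H_{1,1}^{1,1}\!\left(z\,\middle|\begin{array}{c}(0,\frac\alpha2)\\(0,1)\end{array}\right)=\frac1{2\pi{\rm i}}\int_{\gamma-{\rm i}\infty}^{\gamma+{\rm i}\infty}\Gamma(t)\,\Gamma\!\left(1-\tfrac\alpha2 t\right)z^{-t}\,dt,\qquad 0<\gamma<\tfrac2\alpha .$$ Then the expectation exists, the integrals defining the H-functions below converge absolutely and do not depend on $\gamma$, and $$\varphi_{\tilde k}(s)=c\,r\binom{2K}{r}\sum_{l=0}^{r-1}\frac{(-1)^l\binom{r-1}{l}\,H_{1,1}^{1,1}\!\left(\frac{\sigma_{\tilde k}^2}{P}\,s\left(\pi\lambda_b\left((2K-r+l+1)c+\omega_{\tilde k}s^{2/\alpha}\right)\right)^{-\alpha/2}\,\middle|\begin{array}{c}(0,\frac\alpha2)\\(0,1)\end{array}\right)}{(2K-r+l+1)c+\omega_{\tilde k}s^{2/\alpha}} .$$ In the interference-limited regime, i.e. as $\sigma^2/P\to0$ with $\rho_I/P$ (hence $\omega_{\tilde k}$)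 fixed, $$\varphi_{\tilde k}(s)\;\longrightarrow\; c\,r\binom{2K}{r}\sum_{l=0}^{r-1}\frac{(-1)^l\binom{r-1}{l}}{(2K-r+l+1)c+\omega_{\tilde k}s^{2/\alpha}},$$ a limit that does not depend on $\lambda_b$. -/

import Mathlib

open MeasureTheory ProbabilityTheory Filter Topology

noncomputable section

namespace SmallCell

/-! ### Fox's H-function -/

section FoxH

variable {p q : ℕ}

/-- The Mellin–Barnes kernel of `H^{m,n}_{p,q}`, with upper parameters `a j = (a_j, A_j)` and lower
parameters `b j = (b_j, B_j)` (all `A_j, B_j > 0`). `Complex.Gamma` vanishes at the poles of `Γ`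
and `0⁻¹ = 0`, so `(Γ x)⁻¹` is the entire function `1/Γ`. -/
def foxKernel (m n : ℕ) (a : Fin p → ℝ × ℝ) (b : Fin q → ℝ × ℝ) (t : ℂ) : ℂ :=
  (∏ j : Fin q, if (j : ℕ) < m then Complex.Gamma ((b j).1 + (b j).2 * t)
      else (Complex.Gamma (1 - (b j).1 - (b j).2 * t))⁻¹) *
  (∏ j : Fin p, if (j : ℕ) < n then Complex.Gamma (1 - (a j).1 - (a j).2 * t)
      else (Complex.Gamma ((a j).1 + (a j).2 * t))⁻¹)

/-- The vertical line `Re t = γ` separates the poles of the `Γ (b_j + B_j t)`, `j ≤ m` (which lie to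
its left), from those of the `Γ (1 - a_j - A_j t)`, `j ≤ n` (which lie to its right). -/
def FoxSeparates (m n : ℕ) (a : Fin p → ℝ × ℝ) (b : Fin q → ℝ × ℝ) (γ : ℝ) : Prop :=
  (∀ j : Fin q, (j : ℕ) < m → 0 < (b j).1 + (b j).2 * γ) ∧
  (∀ j : Fin p, (j : ℕ) < n → 0 < 1 - (a j).1 - (a j).2 * γ)

/-- The Mellin–Barnes integrand `Θ(t) z^{-t}` on the line `t = γ + i y`. -/
def foxIntegrand (m n : ℕ) (a : Fin p → ℝ × ℝ) (b : Fin q → ℝ × ℝ) (γ : ℝ) (z : ℂ) (y : ℝ) : ℂ :=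
  foxKernel m n a b (γ + y * Complex.I) * z ^ (-(γ + y * Complex.I : ℂ))

/-- `(1 / 2πi) ∫ Θ(t) z^{-t} dt` along the line from `γ - i∞` to `γ + i∞` (`dt = i dy`). -/
def foxLineIntegral (m n : ℕ) (a : Fin p → ℝ × ℝ) (b : Fin q → ℝ × ℝ) (γ : ℝ) (z : ℂ) : ℂ :=
  (1 / (2 * Real.pi) : ℂ) * ∫ y : ℝ, foxIntegrand m n a b γ z y

/-- `w` is the value of `H^{m,n}_{p,q}` at `z`: a separating vertical line exists, and along every
such line the Mellin–Barnes integral converges absolutely and equals `w`. -/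
def IsFoxHValue (m n : ℕ) (a : Fin p → ℝ × ℝ) (b : Fin q → ℝ × ℝ) (z w : ℂ) : Prop :=
  (∃ γ : ℝ, FoxSeparates m n a b γ) ∧
  ∀ γ : ℝ, FoxSeparates m n a b γ →
    Integrable (foxIntegrand m n a b γ z) ∧ foxLineIntegral m n a b γ z = w

open Classical in
/-- Fox's H-function `H^{m,n}_{p,q}(z | a; b)`, for parameters that admit a separating vertical
line: the Mellin–Barnes integral along such a line. -/
def foxH (m n : ℕ) (a : Fin p → ℝ × ℝ) (b : Fin q → ℝ × ℝ) (z : ℂ) : ℂ :=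
  if h : ∃ γ : ℝ, FoxSeparates m n a b γ then foxLineIntegral m n a b h.choose z else 0

end FoxH

/-! ### The network model -/

/-- The constant `c = 5/4` in the law of the distance between a user and its serving station. -/
def cellConst : ℝ := 5 / 4

/-- The density `f_d(x) = 2 c λ_b π x exp (-c λ_b π x²)`, `x ≥ 0`, of the distance between a user
and its serving base station, for base stations of intensity `lam`. -/
def distPDF (lam x : ℝ) : ℝ :=
  if 0 ≤ x then 2 * cellConst * lam * Real.pi * x * Real.exp (-cellConst * lam * Real.pi * x ^ 2)
  else 0

/-- The (Rayleigh) law of the distance between a user and its serving base station. -/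
def distLaw (lam : ℝ) : Measure ℝ :=
  volume.withDensity fun x => ENNReal.ofReal (distPDF lam x)

/-- The entry of rank `i + 1` when the entries of `v` are put in increasing order. -/
def orderStat {n : ℕ} (v : Fin n → ℝ) (i : Fin n) : ℝ := v (Tuple.sort v i)

/-- Path loss `ℓ(d) = d^{-α}`. -/
def pathLoss (α d : ℝ) : ℝ := d ^ (-α)

/-- Noise power `σ_k² = σ² ‖u‖²` after the receive filter `u`. -/
def filteredNoise {N : ℕ} (σ2 : ℝ) (u : EuclideanSpace ℂ (Fin N)) : ℝ := σ2 * ‖u‖ ^ 2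

/-- `ω = Γ(1 - 2/α) ((ρ_I / P) |uᴴ 1|²)^{2/α}`. -/
def interfCoeff {N : ℕ} (α P ρ : ℝ) (u : EuclideanSpace ℂ (Fin N)) : ℝ :=
  Real.Gamma (1 - 2 / α) * ((ρ / P) * ‖∑ i, star (u i)‖ ^ 2) ^ (2 / α)

/-- The variable `exp (-(σ_k² / (P ℓ(d))) s - π λ_b ω d² s^{2/α})`, as a function of `d`. -/
def phiIntegrand {N : ℕ} (α lam P ρ σ2 : ℝ) (u : EuclideanSpace ℂ (Fin N)) (s : ℂ) (d : ℝ) : ℂ :=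
  Complex.exp (-((filteredNoise σ2 u / (P * pathLoss α d) : ℝ) : ℂ) * s
    - ((Real.pi * lam * interfCoeff α P ρ u * d ^ 2 : ℝ) : ℂ) * s ^ ((2 / α : ℝ) : ℂ))

/-- `φ(s) = E_d {exp (-(σ_k² / (P ℓ(d))) s - π λ_b ω d² s^{2/α})}` for a random distance `d`. -/
def phi {Ω : Type*} [MeasurableSpace Ω] (μ : Measure Ω) (d : Ω → ℝ) {N : ℕ} (α lam P ρ σ2 : ℝ)
    (u : EuclideanSpace ℂ (Fin N)) (s : ℂ) : ℂ :=
  ∫ x, phiIntegrand α lam P ρ σ2 u s (d x) ∂μ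

/-- `(2K - r + l + 1) c + ω s^{2/α}`, for `ω = om`. -/
def denom (α om : ℝ) (K r l : ℕ) (s : ℂ) : ℂ :=
  ((2 * (K : ℂ) - r + l + 1) * (cellConst : ℂ)) + (om : ℂ) * s ^ ((2 / α : ℝ) : ℂ)

/-- The argument `(σ_k² / P) s (π λ_b ((2K - r + l + 1) c + ω s^{2/α}))^{-α/2}` of the H-function. -/
def foxArg {N : ℕ} (α lam P ρ σ2 : ℝ) (u : EuclideanSpace ℂ (Fin N)) (K r l : ℕ) (s : ℂ) : ℂ :=
  ((filteredNoise σ2 u / P : ℝ) : ℂ) * s *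
    (((Real.pi * lam : ℝ) : ℂ) * denom α (interfCoeff α P ρ u) K r l s) ^ ((-(α / 2) : ℝ) : ℂ)

end SmallCell

end

/-! The rank-`r` distance has density `r C(2K,r) F^(r-1) (1-F)^(2K-r) F'` with `F = 1 -
exp(-cλπx²)`. Expanding `F^(r-1)` binomially and substituting `v = x²` turns `φ` into a signed sum
of integrals `∫ exp(-Bv - w v^κ) dv` over `v > 0`, where `κ = α/2`, `w = (σ_k²/P) s` and `B = πλ ·
denom` (`integral_phiIntegrand`).

Each of these, times `B`, is an H-function value (`isFoxHValue_expPowIntegral`): write `exp(-w v^κ)`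
as a Cahen–Mellin integral and exchange the integrals; the `v`-integral is then Euler's and gives
`Γ(1-κt) B^(κt-1)`. For complex `s` the powers of `w` and `B` must recombine into a principal power
of `w B^(-κ)`. They do because `denom` is a positive real plus `ω s^(2/α)`, so that `κ |arg B| ≤
|arg s| < π/2` (`denom_re_pos_and_arg`).

The small-noise limit is dominated convergence in the integral form, since `B ∫ exp(-Bv) dv = 1`. -/

namespace SmallCell

/-! ### Euler's integral with a complex rate -/

lemma norm_ofReal_cpow_mul_exp {a ξ : ℂ} {x : ℝ} (hx : 0 < x) :
    ‖(x : ℂ) ^ a * Complex.exp (-(ξ * x))‖ = x ^ a.re * Real.exp (-ξ.re * x ^ (1 : ℝ)) := by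
  rw [norm_mul, Complex.norm_cpow_eq_rpow_re_of_pos hx, Complex.norm_exp]
  simp

lemma continuousOn_ofReal_cpow_mul_exp (a ξ : ℂ) :
    ContinuousOn (fun x : ℝ => (x : ℂ) ^ a * Complex.exp (-(ξ * x))) (Set.Ioi 0) := by
  refine ContinuousOn.mul (fun x hx => ContinuousAt.continuousWithinAt ?_) (by fun_prop)
  exact Complex.continuousAt_ofReal_cpow_const _ _ (Or.inr (ne_of_gt hx))

lemma integrableOn_cpow_mul_exp {a ξ : ℂ} (ha : -1 < a.re) (hξ : 0 < ξ.re) :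
    IntegrableOn (fun x : ℝ => (x : ℂ) ^ a * Complex.exp (-(ξ * x))) (Set.Ioi 0) := by
  refine (integrableOn_rpow_mul_exp_neg_mul_rpow ha one_pos hξ).mono'
    ((continuousOn_ofReal_cpow_mul_exp a ξ).aestronglyMeasurable measurableSet_Ioi) ?_
  filter_upwards [ae_restrict_mem measurableSet_Ioi] with x hx
  exact (norm_ofReal_cpow_mul_exp hx).le

/-- Gives holomorphy in the rate, for the identity theorem. On the ball of radius `Re ξ / 2` the
real part of the rate stays above `Re ξ / 2`, which yields a uniform dominating function. -/
lemma hasDerivAt_integral_cpow_mul_exp {a ξ : ℂ} (ha : -1 < a.re) (hξ : 0 < ξ.re) :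
    HasDerivAt (fun ζ : ℂ => ∫ x : ℝ in Set.Ioi 0, (x : ℂ) ^ a * Complex.exp (-(ζ * x)))
      (∫ x : ℝ in Set.Ioi 0, (x : ℂ) ^ a * (Complex.exp (-(ξ * x)) * -x)) ξ := by
  have hε : 0 < ξ.re / 2 := by linarith
  have ha' : -1 < a.re + 1 := by linarith
  refine (hasDerivAt_integral_of_dominated_loc_of_deriv_le (Metric.ball_mem_nhds ξ hε)
    (bound := fun x : ℝ => x ^ (a.re + 1) * Real.exp (-(ξ.re / 2) * x ^ (1 : ℝ)))
    (F' := fun ζ (x : ℝ) => (x : ℂ) ^ a * (Complex.exp (-(ζ * x)) * -x))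
    (F := fun ζ (x : ℝ) => (x : ℂ) ^ a * Complex.exp (-(ζ * x)))
    ?_ (integrableOn_cpow_mul_exp ha hξ) ?_ ?_
    (integrableOn_rpow_mul_exp_neg_mul_rpow ha' one_pos hε) ?_).2
  · exact Eventually.of_forall fun ζ =>
      (continuousOn_ofReal_cpow_mul_exp a ζ).aestronglyMeasurable measurableSet_Ioi
  · refine ContinuousOn.aestronglyMeasurable ?_ measurableSet_Ioi
    refine ((continuousOn_ofReal_cpow_mul_exp a ξ).mul
      (Continuous.continuousOn (f := fun x : ℝ => -(x : ℂ)) (by fun_prop))).congr ?_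
    intro x _
    exact (mul_assoc _ _ _).symm
  · filter_upwards [ae_restrict_mem measurableSet_Ioi] with x (hx : 0 < x) ζ hζ
    rw [← mul_assoc, norm_mul, norm_ofReal_cpow_mul_exp hx, norm_neg, Complex.norm_real,
      Real.norm_of_nonneg hx.le, Real.rpow_add_one hx.ne', mul_right_comm]
    have h1 : |(ζ - ξ).re| < ξ.re / 2 := (Complex.abs_re_le_norm _).trans_lt
      (by simpa [dist_eq_norm] using hζ)
    rw [Complex.sub_re, abs_lt] at h1
    have h2 : (0 : ℝ) < x ^ (1 : ℝ) := by positivity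
    gcongr
    linarith
  · refine Eventually.of_forall fun x ζ _ => ?_
    have h : HasDerivAt (fun ζ : ℂ => -(ζ * x)) (-x) ζ := by
      simpa using ((hasDerivAt_id ζ).mul_const (x : ℂ)).fun_neg
    exact h.cexp.const_mul _

/-- Euler's integral for `Γ`, with a complex rate. -/
lemma integral_cpow_mul_exp_neg_complex_mul {a ξ : ℂ} (ha : 0 < a.re) (hξ : 0 < ξ.re) :
    ∫ x : ℝ in Set.Ioi 0, (x : ℂ) ^ (a - 1) * Complex.exp (-(ξ * x)) =
      ξ ^ (-a) * Complex.Gamma a := by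
  have hopen : IsOpen {ζ : ℂ | 0 < ζ.re} := isOpen_lt continuous_const Complex.continuous_re
  have ha' : -1 < (a - 1).re := by simpa using ha
  have hf : AnalyticOnNhd ℂ
      (fun ζ : ℂ => ∫ x : ℝ in Set.Ioi 0, (x : ℂ) ^ (a - 1) * Complex.exp (-(ζ * x)))
      {ζ : ℂ | 0 < ζ.re} :=
    DifferentiableOn.analyticOnNhd (fun ζ hζ =>
      (hasDerivAt_integral_cpow_mul_exp ha' hζ).differentiableAt.differentiableWithinAt) hopen
  have hg : AnalyticOnNhd ℂ (fun ζ : ℂ => ζ ^ (-a) * Complex.Gamma a) {ζ : ℂ | 0 < ζ.re} := by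
    refine DifferentiableOn.analyticOnNhd (fun ζ hζ => ?_) hopen
    exact ((differentiableAt_id.cpow_const (Or.inl hζ)).mul_const _).differentiableWithinAt
  -- Identity theorem on the right half-plane: both sides agree at the real rates `1 + 1/(n+1)`,
  -- which accumulate at `1`.
  refine hf.eqOn_of_preconnected_of_frequently_eq hg
    (convex_halfSpace_re_gt 0).isPreconnected (z₀ := 1) (by simp) ?_ hξ
  have ht : Tendsto (fun n : ℕ => ((1 + 1 / ((n : ℝ) + 1) : ℝ) : ℂ)) atTop (𝓝[≠] 1) := by
    refine tendsto_nhdsWithin_iff.2 ⟨?_, Eventually.of_forall fun n => ?_⟩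
    · have := (tendsto_one_div_add_atTop_nhds_zero_nat (𝕜 := ℝ)).const_add 1
      rw [add_zero] at this
      simpa [Function.comp_def] using (Complex.continuous_ofReal.tendsto 1).comp this
    · simp only [Set.mem_compl_iff, Set.mem_singleton_iff]
      have : (0 : ℝ) < 1 / ((n : ℝ) + 1) := by positivity
      intro h
      have h' : (1 + 1 / ((n : ℝ) + 1) : ℝ) = 1 := by exact_mod_cast h
      linarith
  refine ht.frequently (Eventually.of_forall fun n => ?_).frequently
  have hr : (0 : ℝ) < 1 + 1 / ((n : ℝ) + 1) := by positivity
  rw [Complex.integral_cpow_mul_exp_neg_mul_Ioi ha hr, one_div,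
    Complex.inv_cpow _ _ (by rw [Complex.arg_ofReal_of_nonneg hr.le]; exact Real.pi_pos.ne),
    ← Complex.cpow_neg]

/-! ### The Gamma function on vertical lines and the Cahen–Mellin integral -/

/-- Exponential decay of `Γ` along vertical lines, at any rate below `π / 2`. -/
lemma exists_norm_Gamma_mul_exp_le {γ θ : ℝ} (hγ : 0 < γ) (hθ : |θ| < Real.pi / 2) :
    ∃ C : ℝ, ∀ y : ℝ, ‖Complex.Gamma (γ + y * Complex.I)‖ * Real.exp (θ * y) ≤ C := by
  -- At the unimodular rate `ξ = e^{iθ}`, the factor `ξ^(-t)` has norm exactly `e^{θy}`, while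
  -- Euler's integral is bounded in norm by an integral free of `y`.
  set ξ : ℂ := Complex.exp (θ * Complex.I) with hξdef
  have hθ' := abs_lt.1 hθ
  have hξ : 0 < ξ.re := by
    rw [hξdef, Complex.exp_ofReal_mul_I_re]
    exact Real.cos_pos_of_mem_Ioo hθ'
  have hξ0 : ξ ≠ 0 := Complex.exp_ne_zero _
  have hlog : Complex.log ξ = θ * Complex.I := by
    refine Complex.log_exp ?_ ?_ <;> simp <;> linarith [Real.pi_pos, hθ'.1, hθ'.2]
  refine ⟨∫ x : ℝ in Set.Ioi 0, x ^ (γ - 1) * Real.exp (-ξ.re * x ^ (1 : ℝ)), fun y => ?_⟩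
  have ha : 0 < ((γ : ℂ) + y * Complex.I).re := by simpa using hγ
  have h := integral_cpow_mul_exp_neg_complex_mul ha hξ
  have hn : ‖ξ ^ (-((γ : ℂ) + y * Complex.I))‖ = Real.exp (θ * y) := by
    rw [Complex.cpow_def_of_ne_zero hξ0, hlog, Complex.norm_exp]
    simp
  rw [mul_comm, ← hn, ← norm_mul, ← h]
  refine (norm_integral_le_integral_norm _).trans_eq
    (setIntegral_congr_fun measurableSet_Ioi fun x hx => ?_)
  simp only [norm_ofReal_cpow_mul_exp hx]
  simp

lemma continuous_Gamma_vertical {γ : ℝ} (hγ : 0 < γ) :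
    Continuous fun y : ℝ => Complex.Gamma (γ + y * Complex.I) := by
  refine continuous_iff_continuousAt.2 fun y => ?_
  refine ContinuousAt.comp (g := Complex.Gamma) (f := fun y : ℝ => (γ : ℂ) + y * Complex.I) ?_
    (by fun_prop)
  refine (Complex.differentiableAt_Gamma _ fun m h => ?_).continuousAt
  have := congrArg Complex.re h
  simp at this
  linarith [(Nat.cast_nonneg m : (0 : ℝ) ≤ m)]

lemma integrable_exp_neg_mul_abs {δ : ℝ} (hδ : 0 < δ) :
    Integrable fun y : ℝ => Real.exp (-δ * |y|) := by
  have h1 : IntegrableOn (fun y : ℝ => Real.exp (-δ * |y|)) (Set.Ioi 0) :=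
    (exp_neg_integrableOn_Ioi 0 hδ).congr_fun
      (fun y hy => by simp only [abs_of_pos (Set.mem_Ioi.1 hy)]) measurableSet_Ioi
  have h2 : IntegrableOn (fun y : ℝ => Real.exp (-δ * |y|)) (Set.Iic 0) :=
    (integrableOn_exp_mul_Iic hδ 0).congr_fun
      (fun y hy => by simp only [abs_of_nonpos (Set.mem_Iic.1 hy)]; ring_nf) measurableSet_Iic
  rw [← integrableOn_univ, ← Set.Iic_union_Ioi (a := (0 : ℝ))]
  exact h2.union h1

lemma norm_cpow_vertical {w : ℂ} (hw : w ≠ 0) (γ y : ℝ) :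
    ‖w ^ (-((γ : ℂ) + y * Complex.I))‖ = ‖w‖ ^ (-γ) * Real.exp (w.arg * y) := by
  rw [Complex.norm_cpow_of_ne_zero hw]
  simp [Real.exp_neg]

/-- The power contributes `e^{y arg w}` with `|arg w| < π/2`; decay of `Γ` at a rate `θ` strictly
between `|arg w|` and `π/2` wins in both directions. -/
lemma integrable_Gamma_mul_cpow {γ : ℝ} (hγ : 0 < γ) {w : ℂ} (hw : 0 < w.re) :
    Integrable fun y : ℝ => Complex.Gamma (γ + y * Complex.I) *
      w ^ (-((γ : ℂ) + y * Complex.I)) := by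
  have hw0 : w ≠ 0 := by rintro rfl; simp at hw
  have harg : |w.arg| < Real.pi / 2 := Complex.abs_arg_lt_pi_div_two_iff.2 (Or.inl hw)
  obtain ⟨θ, h1, h2⟩ := exists_between harg
  have hθ0 : 0 ≤ θ := (abs_nonneg _).trans h1.le
  obtain ⟨C₁, hC₁⟩ := exists_norm_Gamma_mul_exp_le hγ (θ := θ) (by rwa [abs_of_nonneg hθ0])
  obtain ⟨C₂, hC₂⟩ := exists_norm_Gamma_mul_exp_le hγ (θ := -θ)
    (by rwa [abs_neg, abs_of_nonneg hθ0])
  have hbound : Integrable fun y : ℝ => max C₁ C₂ * ‖w‖ ^ (-γ) *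
      Real.exp (-(θ - |w.arg|) * |y|) :=
    (integrable_exp_neg_mul_abs (sub_pos.2 h1)).const_mul _
  refine hbound.mono' ?_ (Eventually.of_forall fun y => ?_)
  · refine ((continuous_Gamma_vertical hγ).mul ?_).aestronglyMeasurable
    exact Continuous.const_cpow (by fun_prop) (Or.inl hw0)
  · rw [norm_mul, norm_cpow_vertical hw0]
    have hG : ‖Complex.Gamma (γ + y * Complex.I)‖ * Real.exp (θ * |y|) ≤ max C₁ C₂ := by
      rcases abs_cases y with ⟨h, _⟩ | ⟨h, _⟩
      · rw [h]; exact (hC₁ y).trans (le_max_left _ _)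
      · rw [h]; exact le_trans (by simpa using hC₂ y) (le_max_right _ _)
    have hE : Real.exp (w.arg * y) ≤ Real.exp (θ * |y|) * Real.exp (-(θ - |w.arg|) * |y|) := by
      rw [← Real.exp_add]
      refine Real.exp_le_exp.2 ?_
      calc w.arg * y ≤ |w.arg * y| := le_abs_self _
        _ = θ * |y| + -(θ - |w.arg|) * |y| := by rw [abs_mul]; ring
    calc ‖Complex.Gamma (γ + y * Complex.I)‖ * (‖w‖ ^ (-γ) * Real.exp (w.arg * y))
        ≤ ‖Complex.Gamma (γ + y * Complex.I)‖ * (‖w‖ ^ (-γ) *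
          (Real.exp (θ * |y|) * Real.exp (-(θ - |w.arg|) * |y|))) := by gcongr
      _ = (‖Complex.Gamma (γ + y * Complex.I)‖ * Real.exp (θ * |y|)) * (‖w‖ ^ (-γ) *
          Real.exp (-(θ - |w.arg|) * |y|)) := by ring
      _ ≤ max C₁ C₂ * (‖w‖ ^ (-γ) * Real.exp (-(θ - |w.arg|) * |y|)) := by gcongr
      _ = _ := by ring

/-- Mellin inversion for the exponential (the Cahen–Mellin integral). -/
lemma exp_neg_mul_eq_integral_Gamma {γ : ℝ} (hγ : 0 < γ) {w : ℂ} (hw : 0 < w.re) {x : ℝ}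
    (hx : 0 < x) :
    Complex.exp (-(w * x)) = (1 / (2 * Real.pi) : ℂ) * ∫ y : ℝ,
      (Complex.Gamma (γ + y * Complex.I) * w ^ (-((γ : ℂ) + y * Complex.I))) *
        (x : ℂ) ^ (-((γ : ℂ) + y * Complex.I)) := by
  have hm : ∀ y : ℝ, mellin (fun x : ℝ => Complex.exp (-(w * x))) (γ + y * Complex.I) =
      w ^ (-((γ : ℂ) + y * Complex.I)) * Complex.Gamma (γ + y * Complex.I) := fun y => by
    simp only [mellin, smul_eq_mul]
    exact integral_cpow_mul_exp_neg_complex_mul (by simpa using hγ) hw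
  have h := mellinInv_mellin_eq γ (fun x : ℝ => Complex.exp (-(w * x))) hx ?_ ?_ ?_
  · rw [← h, mellinInv]
    simp only [hm, smul_eq_mul, Complex.real_smul]
    push_cast
    congr 1
    refine integral_congr_ae (Eventually.of_forall fun y => ?_)
    ring
  · exact integrableOn_cpow_mul_exp (by simpa using hγ) hw
  · simp only [Complex.VerticalIntegrable, hm]
    exact (integrable_Gamma_mul_cpow hγ hw).congr (Eventually.of_forall fun y => mul_comm _ _)
  · exact Continuous.continuousAt (by fun_prop)

/-! ### Evaluation of the H-function by Fubini -/

lemma foxSeparates_iff {α γ : ℝ} :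
    FoxSeparates 1 1 ![((0 : ℝ), α / 2)] ![((0 : ℝ), (1 : ℝ))] γ ↔ 0 < γ ∧ α / 2 * γ < 1 := by
  simp [FoxSeparates]

lemma foxKernel_eq (α : ℝ) (t : ℂ) :
    foxKernel 1 1 ![((0 : ℝ), α / 2)] ![((0 : ℝ), (1 : ℝ))] t =
      Complex.Gamma t * Complex.Gamma (1 - (α / 2 : ℝ) * t) := by
  simp [foxKernel]

/-- If `|κ arg B| < π / 2` and `Re w > 0`, the principal powers of `w B^{-κ}` split. -/
lemma mul_cpow_cpow_neg {w B : ℂ} {κ : ℝ} (hw : 0 < w.re) (hB : B ≠ 0)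
    (hκ : |κ * B.arg| < Real.pi / 2) (t : ℂ) :
    (w * B ^ ((-κ : ℝ) : ℂ)) ^ (-t) = w ^ (-t) * B ^ (κ * t) := by
  have hw0 : w ≠ 0 := by rintro rfl; simp at hw
  have hwarg := abs_lt.1 (Complex.abs_arg_lt_pi_div_two_iff.2 (Or.inl hw))
  have hκ' := abs_lt.1 hκ
  have hpow : B ^ ((-κ : ℝ) : ℂ) = Complex.exp (Complex.log B * ((-κ : ℝ) : ℂ)) :=
    Complex.cpow_def_of_ne_zero hB _
  have him : (Complex.log B * ((-κ : ℝ) : ℂ)).im = -(κ * B.arg) := by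
    rw [Complex.im_mul_ofReal, Complex.log_im]; ring
  have hlogB : Complex.log (B ^ ((-κ : ℝ) : ℂ)) = Complex.log B * ((-κ : ℝ) : ℂ) := by
    rw [hpow]
    refine Complex.log_exp ?_ ?_ <;> rw [him] <;> linarith [Real.pi_pos, hκ'.1, hκ'.2]
  have hargB : (B ^ ((-κ : ℝ) : ℂ)).arg = -(κ * B.arg) := by
    rw [← Complex.log_im, hlogB, him]
  have hne : B ^ ((-κ : ℝ) : ℂ) ≠ 0 := by rw [hpow]; exact Complex.exp_ne_zero _
  -- Both arguments are below `π/2` in absolute value, so their sum does not cross the branch cut.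
  have hlog := Complex.log_mul hw0 hne (by
    rw [hargB]; constructor <;> linarith [hκ'.1, hκ'.2, hwarg.1, hwarg.2])
  rw [Complex.cpow_def_of_ne_zero (mul_ne_zero hw0 hne), hlog, hlogB,
    Complex.cpow_def_of_ne_zero hw0, Complex.cpow_def_of_ne_zero hB, ← Complex.exp_add]
  congr 1
  push_cast
  ring

lemma ofReal_rpow_cpow {v : ℝ} (hv : 0 < v) (κ : ℝ) (t : ℂ) :
    ((v ^ κ : ℝ) : ℂ) ^ t = (v : ℂ) ^ (κ * t) := by
  rw [Complex.cpow_def_of_ne_zero (by exact_mod_cast (Real.rpow_pos_of_pos hv κ).ne'),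
    Complex.cpow_def_of_ne_zero (by exact_mod_cast hv.ne'), ← Complex.ofReal_log hv.le,
    ← Complex.ofReal_log (Real.rpow_pos_of_pos hv κ).le, Real.log_rpow hv]
  congr 1
  push_cast
  ring

/-- The function of `(v, y)` behind the evaluation of the H-function by Fubini's theorem. -/
noncomputable def foxFubini (κ γ : ℝ) (w B : ℂ) (v y : ℝ) : ℂ :=
  Complex.exp (-(B * v)) * ((Complex.Gamma (γ + y * Complex.I) *
    w ^ (-((γ : ℂ) + y * Complex.I))) * (v : ℂ) ^ (-(κ * ((γ : ℂ) + y * Complex.I))))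

/-- The norm splits into a function of `v` times one of `y`, because `|v^(-κt)|` depends only on `Re
t = γ`. Integrability at `v = 0` is the condition `κγ < 1`. -/
lemma integrable_foxFubini {κ γ : ℝ} {w B : ℂ} (hγ : 0 < γ) (hκγ : κ * γ < 1) (hw : 0 < w.re)
    (hB : 0 < B.re) :
    Integrable (Function.uncurry (foxFubini κ γ w B))
      ((volume.restrict (Set.Ioi 0)).prod volume) := by
  have h1 : IntegrableOn (fun v : ℝ => v ^ (-(κ * γ)) * Real.exp (-B.re * v ^ (1 : ℝ)))
      (Set.Ioi 0) := integrableOn_rpow_mul_exp_neg_mul_rpow (by linarith) one_pos hB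
  have h2 := integrable_Gamma_mul_cpow hγ hw
  refine (h1.mul_prod h2.norm).mono' ?_ ?_
  · have hm : AEStronglyMeasurable (fun p : ℝ × ℝ => Complex.Gamma (γ + p.2 * Complex.I) *
        w ^ (-((γ : ℂ) + p.2 * Complex.I))) ((volume.restrict (Set.Ioi 0)).prod volume) :=
      h2.aestronglyMeasurable.comp_snd
    refine AEStronglyMeasurable.mul (Continuous.aestronglyMeasurable (by fun_prop)) (hm.mul ?_)
    exact Measurable.aestronglyMeasurable (by fun_prop)
  · have hpos : ∀ᵐ p : ℝ × ℝ ∂((volume.restrict (Set.Ioi 0)).prod volume), 0 < p.1 :=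
      Measure.quasiMeasurePreserving_fst.ae (ae_restrict_mem measurableSet_Ioi)
    filter_upwards [hpos] with p hp
    rw [Function.uncurry, foxFubini, norm_mul, norm_mul _ ((p.1 : ℂ) ^ _),
      Complex.norm_cpow_eq_rpow_re_of_pos hp, Complex.norm_exp]
    refine le_of_eq ?_
    simp
    ring

lemma integral_foxFubini_fst {κ γ : ℝ} {w B : ℂ} (hκγ : κ * γ < 1) (hw : 0 < w.re)
    (hB : 0 < B.re) (hκ : |κ * B.arg| < Real.pi / 2) (y : ℝ) :
    B * ∫ v in Set.Ioi 0, foxFubini κ γ w B v y =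
      Complex.Gamma (γ + y * Complex.I) * Complex.Gamma (1 - κ * (γ + y * Complex.I)) *
        (w * B ^ ((-κ : ℝ) : ℂ)) ^ (-((γ : ℂ) + y * Complex.I)) := by
  have hB0 : B ≠ 0 := by rintro rfl; simp at hB
  set t : ℂ := (γ : ℂ) + y * Complex.I with ht
  have ha : 0 < (1 - κ * t).re := by simp [ht]; linarith
  have h := integral_cpow_mul_exp_neg_complex_mul ha hB
  have : ∀ v : ℝ, foxFubini κ γ w B v y = Complex.Gamma t * w ^ (-t) *
      ((v : ℂ) ^ ((1 - κ * t) - 1) * Complex.exp (-(B * v))) := fun v => by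
    rw [foxFubini, ← ht, show (1 - κ * t) - 1 = -(κ * t) by ring]; ring
  simp only [this]
  rw [integral_const_mul, h, mul_cpow_cpow_neg hw hB0 hκ,
    show -(1 - κ * t) = κ * t - 1 by ring, Complex.cpow_sub _ _ hB0, Complex.cpow_one]
  field_simp

/-- The integral `B ∫ exp (-B v - w v^κ) dv`, which the H-function represents. -/
noncomputable def expPowIntegral (κ : ℝ) (w B : ℂ) : ℂ :=
  B * ∫ v : ℝ in Set.Ioi 0, Complex.exp (-(B * v)) * Complex.exp (-(w * (v ^ κ : ℝ)))

/-- The target does not contain `γ`, so evaluating every separating line separately proves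
independence of `γ` without shifting contours. Absolute convergence comes from the same Fubini
argument. -/
lemma isFoxHValue_expPowIntegral {α : ℝ} {w B : ℂ} (hα : 0 < α) (hw : 0 < w.re) (hB : 0 < B.re)
    (harg : |α / 2 * B.arg| < Real.pi / 2) :
    IsFoxHValue 1 1 ![((0 : ℝ), α / 2)] ![((0 : ℝ), (1 : ℝ))]
      (w * B ^ ((-(α / 2) : ℝ) : ℂ)) (expPowIntegral (α / 2) w B) := by
  -- `1/α` is the midpoint of the admissible interval `(0, 2/α)`.
  refine ⟨⟨1 / α, foxSeparates_iff.2 ⟨by positivity, by field_simp; norm_num⟩⟩, fun γ hγ => ?_⟩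
  obtain ⟨hγ0, hγ1⟩ := foxSeparates_iff.1 hγ
  have hF := integrable_foxFubini hγ0 hγ1 hw hB
  have hI : ∀ y : ℝ, foxIntegrand 1 1 ![((0 : ℝ), α / 2)] ![((0 : ℝ), (1 : ℝ))] γ
      (w * B ^ ((-(α / 2) : ℝ) : ℂ)) y =
        B * ∫ v in Set.Ioi 0, foxFubini (α / 2) γ w B v y := fun y => by
    rw [foxIntegrand, foxKernel_eq, integral_foxFubini_fst hγ1 hw hB harg]
  refine ⟨(hF.integral_prod_right.const_mul B).congr (Eventually.of_forall fun y => (hI y).symm), ?_⟩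
  simp only [foxLineIntegral, hI, expPowIntegral]
  rw [integral_const_mul, ← integral_integral_swap hF, mul_left_comm, ← integral_const_mul]
  congr 1
  refine setIntegral_congr_fun measurableSet_Ioi fun v (hv : 0 < v) => ?_
  simp only [foxFubini]
  rw [integral_const_mul, exp_neg_mul_eq_integral_Gamma hγ0 hw (Real.rpow_pos_of_pos hv (α / 2)),
    mul_left_comm]
  simp only [ofReal_rpow_cpow hv, mul_neg]

lemma IsFoxHValue.foxH_eq {p q m n : ℕ} {a : Fin p → ℝ × ℝ} {b : Fin q → ℝ × ℝ} {z w : ℂ}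
    (h : IsFoxHValue m n a b z w) : foxH m n a b z = w := by
  rw [foxH, dif_pos h.1]
  exact (h.2 _ h.1.choose_spec).2

/-! ### Order statistics of an i.i.d. sample -/

lemma orderStat_le_iff {n : ℕ} (v : Fin n → ℝ) (i : Fin n) (x : ℝ) :
    orderStat v i ≤ x ↔ (i : ℕ) < (Finset.univ.filter fun j => v j ≤ x).card := by
  rw [orderStat, ← Function.comp_apply (f := v),
    ← Tuple.lt_card_le_iff_apply_le_of_monotone (Tuple.monotone_sort v)]
  refine iff_of_eq (congrArg _ ?_)
  refine Finset.card_bij (fun j _ => Tuple.sort v j) ?_ ?_ ?_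
  · intro j hj
    simpa using hj
  · intro j _ k _ h
    exact (Tuple.sort v).injective h
  · intro j hj
    exact ⟨(Tuple.sort v).symm j, by simpa using hj, by simp⟩

lemma setOf_filter_le_eq {n : ℕ} (x : ℝ) (S : Finset (Fin n)) :
    {v : Fin n → ℝ | (Finset.univ.filter fun j => v j ≤ x) = S} =
      Set.univ.pi fun j => if j ∈ S then Set.Iic x else Set.Ioi x := by
  ext v
  simp only [Set.mem_ofPred_eq, Finset.ext_iff, Finset.mem_filter, Finset.mem_univ, true_and,
    Set.mem_pi, Set.mem_univ, forall_const]
  refine forall_congr' fun j => ?_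
  by_cases h : j ∈ S <;> simp [h]

/-- Sorting the vectors by the exact set `S` of entries at most `x` gives disjoint boxes, which
serve both measurability and the computation of probabilities. -/
lemma setOf_orderStat_le {n : ℕ} (i : Fin n) (x : ℝ) :
    {v : Fin n → ℝ | orderStat v i ≤ x} =
      ⋃ S ∈ (Finset.univ : Finset (Fin n)).powerset.filter (fun S => (i : ℕ) < S.card),
        Set.univ.pi fun j => if j ∈ S then Set.Iic x else Set.Ioi x := by
  ext v
  simp only [← setOf_filter_le_eq, orderStat_le_iff]
  simp

lemma measurableSet_pi_Iic_Ioi {n : ℕ} (x : ℝ) (S : Finset (Fin n)) :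
    MeasurableSet (Set.univ.pi fun j : Fin n => if j ∈ S then Set.Iic x else Set.Ioi x) := by
  refine MeasurableSet.univ_pi fun j => ?_
  split_ifs <;> measurability

lemma measurable_orderStat {n : ℕ} (i : Fin n) :
    Measurable fun v : Fin n → ℝ => orderStat v i := by
  refine measurable_of_Iic fun x => ?_
  change MeasurableSet {v : Fin n → ℝ | orderStat v i ≤ x}
  rw [setOf_orderStat_le]
  exact Finset.measurableSet_biUnion _ fun S _ => measurableSet_pi_Iic_Ioi x S

/-- The probability that a binomial variable with `n` trials exceeds `i`, as a polynomial in the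
success probability. -/
noncomputable def bernsteinTail (n i : ℕ) : Polynomial ℝ :=
  ∑ k ∈ Finset.Ico i n, bernsteinPolynomial ℝ n (k + 1)

lemma bernsteinTail_eval_zero (n i : ℕ) : (bernsteinTail n i).eval 0 = 0 := by
  simp [bernsteinTail, Polynomial.eval_finsetSum, bernsteinPolynomial.eval_at_0]

/-- The derivatives telescope, and the upper end term vanishes because its index `n` exceeds the
degree `n - 1`. -/
lemma derivative_bernsteinTail {n i : ℕ} (hi : i < n) :
    (bernsteinTail n i).derivative = (n : Polynomial ℝ) * bernsteinPolynomial ℝ (n - 1) i := by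
  simp only [bernsteinTail, Polynomial.derivative_sum, bernsteinPolynomial.derivative_succ]
  rw [← Finset.mul_sum, Finset.sum_Ico_eq_sub _ hi.le, Finset.sum_range_sub',
    Finset.sum_range_sub', bernsteinPolynomial.eq_zero_of_lt ℝ (show n - 1 < n by omega)]
  ring

lemma pi_orderStat_le {n : ℕ} (ν : Measure ℝ) [IsProbabilityMeasure ν] (i : Fin n) {x p : ℝ}
    (hp0 : 0 ≤ p) (hp1 : p ≤ 1) (hp : ν (Set.Iic x) = ENNReal.ofReal p) :
    (Measure.pi fun _ : Fin n => ν) {v | orderStat v i ≤ x} =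
      ENNReal.ofReal ((bernsteinTail n i).eval p) := by
  have hq0 : 0 ≤ 1 - p := sub_nonneg.2 hp1
  have hq : ν (Set.Ioi x) = ENNReal.ofReal (1 - p) := by
    rw [← Set.compl_Iic, prob_compl_eq_one_sub measurableSet_Iic, hp,
      ENNReal.ofReal_sub _ hp0, ENNReal.ofReal_one]
  rw [setOf_orderStat_le, measure_biUnion_finset ?_ fun S _ => measurableSet_pi_Iic_Ioi x S]
  · have h : ∀ S : Finset (Fin n), (Measure.pi fun _ : Fin n => ν)
        (Set.univ.pi fun j => if j ∈ S then Set.Iic x else Set.Ioi x) =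
          ENNReal.ofReal (p ^ S.card * (1 - p) ^ (n - S.card)) := fun S => by
      have h' : ∀ j, ν (if j ∈ S then Set.Iic x else Set.Ioi x) =
          if j ∈ S then ENNReal.ofReal p else ENNReal.ofReal (1 - p) := fun j => by
        split_ifs <;> assumption
      rw [Measure.pi_pi]
      simp only [h']
      rw [Finset.prod_ite, Finset.prod_const, Finset.prod_const,
        ENNReal.ofReal_mul (by positivity), ENNReal.ofReal_pow hp0, ENNReal.ofReal_pow hq0]
      congr 2
      · simp
      · rw [Finset.filter_not, Finset.card_sdiff]
        simp
    simp only [h]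
    rw [← ENNReal.ofReal_sum_of_nonneg fun S _ => by positivity, Finset.sum_filter]
    congr 1
    -- The probability of a box depends only on `S.card`, so grouping by cardinality produces the
    -- binomial coefficients.
    rw [Finset.sum_powerset_apply_card
      (fun k => if (i : ℕ) < k then p ^ k * (1 - p) ^ (n - k) else 0), Finset.card_univ,
      Fintype.card_fin, bernsteinTail, Polynomial.eval_finsetSum, Finset.sum_range_succ']
    have hi := i.2
    simp only [not_lt_zero, if_false, smul_zero, add_zero]
    rw [Finset.range_eq_Ico, ← Finset.sum_Ico_consecutive _ (Nat.zero_le _) hi.le,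
      Finset.sum_eq_zero, zero_add]
    · refine Finset.sum_congr rfl fun k hk => ?_
      rw [Finset.mem_Ico] at hk
      rw [if_pos (by omega)]
      simp [bernsteinPolynomial, mul_assoc]
    · intro k hk
      rw [Finset.mem_Ico] at hk
      rw [if_neg (by omega), smul_zero]
  · intro S _ T _ hST
    simp only [Function.onFun, ← setOf_filter_le_eq]
    exact Set.disjoint_left.2 fun v hS hT => hST (hS.symm.trans hT)

/-! ### Rayleigh distances and the law of the ranked distance -/

/-- The Rayleigh distribution function, for the rate `b`. -/
noncomputable def rayleighCDF (b x : ℝ) : ℝ := 1 - Real.exp (-b * (max x 0) ^ 2)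

lemma rayleighCDF_nonneg {b : ℝ} (hb : 0 < b) (x : ℝ) : 0 ≤ rayleighCDF b x := by
  rw [rayleighCDF, sub_nonneg, Real.exp_le_one_iff]
  nlinarith [sq_nonneg (max x 0)]

lemma rayleighCDF_le_one (b x : ℝ) : rayleighCDF b x ≤ 1 := by
  rw [rayleighCDF]
  linarith [Real.exp_pos (-b * (max x 0) ^ 2)]

/-- The measure with density `G'(F) F'` on `[0, ∞)` has distribution function `G(F) - G(0)`,
where `F` is the Rayleigh distribution function. -/
lemma withDensity_rayleigh_Iic {b : ℝ} (hb : 0 < b) (G : Polynomial ℝ)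
    (hG : ∀ p ∈ Set.Icc (0 : ℝ) 1, 0 ≤ G.derivative.eval p) (x : ℝ) :
    (volume.withDensity fun t => ENNReal.ofReal (if 0 ≤ t then
      G.derivative.eval (1 - Real.exp (-b * t ^ 2)) * (2 * b * t * Real.exp (-b * t ^ 2))
      else 0)) (Set.Iic x) = ENNReal.ofReal (G.eval (rayleighCDF b x) - G.eval 0) := by
  set q : ℝ → ℝ := fun t =>
    G.derivative.eval (1 - Real.exp (-b * t ^ 2)) * (2 * b * t * Real.exp (-b * t ^ 2)) with hq
  have hqc : Continuous q := by fun_prop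
  have hind : (fun t => ENNReal.ofReal (if 0 ≤ t then q t else 0)) =
      (Set.Ici 0).indicator fun t => ENNReal.ofReal (q t) := by
    funext t
    by_cases h : 0 ≤ t <;> simp [h]
  change (volume.withDensity fun t => ENNReal.ofReal (if 0 ≤ t then q t else 0)) _ = _
  rw [withDensity_apply _ measurableSet_Iic, hind, setLIntegral_indicator measurableSet_Ici,
    Set.Ici_inter_Iic]
  rcases lt_or_ge x 0 with hx | hx
  · simp [Set.Icc_eq_empty (not_le.2 hx), rayleighCDF, max_eq_right hx.le]
  · rw [← ofReal_integral_eq_lintegral_ofReal hqc.integrableOn_Icc, integral_Icc_eq_integral_Ioc,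
      ← intervalIntegral.integral_of_le hx]
    · congr 1
      have hd : ∀ t : ℝ, HasDerivAt (fun t => G.eval (1 - Real.exp (-b * t ^ 2))) (q t) t := by
        intro t
        have h1 : HasDerivAt (fun t : ℝ => 1 - Real.exp (-b * t ^ 2))
            (2 * b * t * Real.exp (-b * t ^ 2)) t := by
          have := (((hasDerivAt_pow 2 t).const_mul (-b)).exp).const_sub 1
          convert! this using 1
          push_cast
          ring
        exact (G.hasDerivAt _).comp t h1
      rw [intervalIntegral.integral_eq_sub_of_hasDerivAt (fun t _ => hd t)
        (hqc.intervalIntegrable _ _)]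
      simp [rayleighCDF, max_eq_left hx]
    · filter_upwards [ae_restrict_mem measurableSet_Icc] with t ht
      have h1 : Real.exp (-b * t ^ 2) ≤ 1 := Real.exp_le_one_iff.2 (by nlinarith [sq_nonneg t])
      have h2 := hG (1 - Real.exp (-b * t ^ 2))
        ⟨by linarith, by linarith [Real.exp_pos (-b * t ^ 2)]⟩
      have := ht.1
      simp only [hq, Pi.zero_apply]
      positivity

/-- The density of the order statistic of rank `i + 1` among `n` Rayleigh variables of rate `b`. -/
noncomputable def orderStatPDF (n i : ℕ) (b x : ℝ) : ℝ :=
  if 0 ≤ x then (bernsteinTail n i).derivative.eval (1 - Real.exp (-b * x ^ 2)) *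
    (2 * b * x * Real.exp (-b * x ^ 2)) else 0

lemma bernsteinTail_derivative_eval_nonneg {n i : ℕ} (hi : i < n) {p : ℝ}
    (hp : p ∈ Set.Icc (0 : ℝ) 1) : 0 ≤ (bernsteinTail n i).derivative.eval p := by
  have h0 := hp.1
  have h1 := sub_nonneg.2 hp.2
  rw [derivative_bernsteinTail hi]
  simp only [bernsteinPolynomial, Polynomial.eval_mul, Polynomial.eval_natCast,
    Polynomial.eval_pow, Polynomial.eval_X, Polynomial.eval_sub, Polynomial.eval_one]
  positivity

lemma distLaw_Iic {lam : ℝ} (hlam : 0 < lam) (x : ℝ) :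
    distLaw lam (Set.Iic x) = ENNReal.ofReal (rayleighCDF (cellConst * lam * Real.pi) x) := by
  have hb : 0 < cellConst * lam * Real.pi := by
    have := Real.pi_pos
    unfold cellConst
    positivity
  -- `G = X` gives the Rayleigh law itself; `G = bernsteinTail` will give the order statistics.
  have h := withDensity_rayleigh_Iic hb Polynomial.X (fun p _ => by simp) x
  simp only [Polynomial.eval_X, sub_zero] at h
  rw [← h, distLaw]
  congr 2
  funext t
  congr 1
  simp only [distPDF, Polynomial.derivative_X, Polynomial.eval_one, one_mul]
  ring_nf

lemma map_pi_orderStat {n : ℕ} {lam : ℝ} (hlam : 0 < lam) [IsProbabilityMeasure (distLaw lam)]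
    (i : Fin n) :
    (Measure.pi fun _ : Fin n => distLaw lam).map (fun v => orderStat v i) =
      volume.withDensity fun x =>
        ENNReal.ofReal (orderStatPDF n i (cellConst * lam * Real.pi) x) := by
  have hb : 0 < cellConst * lam * Real.pi := by
    have := Real.pi_pos
    unfold cellConst
    positivity
  have := Measure.isFiniteMeasure_map (Measure.pi fun _ : Fin n => distLaw lam)
    (fun v => orderStat v i)
  refine Measure.ext_of_Iic _ _ fun x => ?_
  rw [Measure.map_apply (measurable_orderStat i) measurableSet_Iic]
  simp only [orderStatPDF]
  rw [withDensity_rayleigh_Iic hb _ fun p hp => bernsteinTail_derivative_eval_nonneg i.2 hp,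
    bernsteinTail_eval_zero, sub_zero]
  exact pi_orderStat_le _ i (rayleighCDF_nonneg hb x) (rayleighCDF_le_one _ x)
    (distLaw_Iic hlam x)

lemma hasLaw_orderStat {Ω : Type*} [MeasurableSpace Ω] {μ : Measure Ω} [IsProbabilityMeasure μ]
    {n : ℕ} {lam : ℝ} (hlam : 0 < lam) {D : Fin n → Ω → ℝ}
    (hD : ∀ i, HasLaw (D i) (distLaw lam) μ) (hindep : iIndepFun D μ) (i : Fin n) :
    HasLaw (fun x => orderStat (fun j => D j x) i) (volume.withDensity fun x =>
      ENNReal.ofReal (orderStatPDF n i (cellConst * lam * Real.pi) x)) μ := by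
  have hm : ∀ j, AEMeasurable (D j) μ := fun j => (hD j).aemeasurable
  -- Total mass one is inherited from `μ`, as `distLaw lam` is the law of `D i`.
  have : IsProbabilityMeasure (distLaw lam) := by
    rw [← (hD i).map_eq]
    exact Measure.isProbabilityMeasure_map (hm i)
  have hmv : AEMeasurable (fun x j => D j x) μ := aemeasurable_pi_lambda _ hm
  refine ⟨(measurable_orderStat i).comp_aemeasurable hmv, ?_⟩
  have h := AEMeasurable.map_map_of_aemeasurable (measurable_orderStat i).aemeasurable hmv
  rw [(iIndepFun_iff_map_fun_eq_pi_map hm).1 hindep] at h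
  simp only [(hD _).map_eq] at h
  rw [map_pi_orderStat hlam] at h
  exact h.symm

/-! ### The vanishing-noise limit of the integral -/

lemma norm_exp_mul_exp_rpow_le {κ : ℝ} {w B : ℂ} (hw : 0 ≤ w.re) {v : ℝ} (hv : 0 < v) :
    ‖Complex.exp (-(B * v)) * Complex.exp (-(w * (v ^ κ : ℝ)))‖ ≤ Real.exp (-B.re * v) := by
  rw [norm_mul, Complex.norm_exp, Complex.norm_exp]
  have h : Real.exp (-(w * (v ^ κ : ℝ))).re ≤ 1 := by
    rw [Real.exp_le_one_iff, Complex.neg_re, Complex.re_mul_ofReal, neg_nonpos]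
    positivity
  calc _ ≤ Real.exp (-(B * v)).re * 1 := by gcongr
    _ = Real.exp (-B.re * v) := by simp

lemma measurable_exp_mul_exp_rpow (κ : ℝ) (w B : ℂ) :
    Measurable fun v : ℝ => Complex.exp (-(B * v)) * Complex.exp (-(w * (v ^ κ : ℝ))) := by
  fun_prop

lemma integrableOn_exp_mul_exp_rpow (κ : ℝ) {w B : ℂ} (hw : 0 ≤ w.re) (hB : 0 < B.re) :
    IntegrableOn (fun v : ℝ => Complex.exp (-(B * v)) * Complex.exp (-(w * (v ^ κ : ℝ))))
      (Set.Ioi 0) := by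
  refine (exp_neg_integrableOn_Ioi 0 hB).mono'
    (measurable_exp_mul_exp_rpow κ w B).aestronglyMeasurable ?_
  filter_upwards [ae_restrict_mem measurableSet_Ioi] with v hv
  exact norm_exp_mul_exp_rpow_le hw hv

lemma expPowIntegral_zero (κ : ℝ) {B : ℂ} (hB : 0 < B.re) : expPowIntegral κ 0 B = 1 := by
  have hB0 : B ≠ 0 := by rintro rfl; simp at hB
  have h := integral_exp_mul_complex_Ioi (a := -B) (by simpa using hB) 0
  simp only [neg_mul] at h
  simp [expPowIntegral, h, hB0]

/-- For `η ≥ 0` the noise factor has norm at most one, so `exp(-v Re B)` dominates; hence the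
one-sided neighbourhood. -/
lemma tendsto_expPowIntegral (κ : ℝ) {s B : ℂ} (hs : 0 < s.re) (hB : 0 < B.re) :
    Tendsto (fun η : ℝ => expPowIntegral κ (η * s) B) (𝓝[≥] 0) (𝓝 1) := by
  have h : ContinuousWithinAt (fun η : ℝ => ∫ v : ℝ in Set.Ioi 0,
      Complex.exp (-(B * v)) * Complex.exp (-(η * s * (v ^ κ : ℝ)))) (Set.Ici 0) 0 := by
    refine continuousWithinAt_of_dominated (bound := fun v => Real.exp (-B.re * v))
      (Eventually.of_forall fun η => (measurable_exp_mul_exp_rpow κ _ B).aestronglyMeasurable) ?_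
      (exp_neg_integrableOn_Ioi 0 hB) (Eventually.of_forall fun v => ?_)
    · filter_upwards [self_mem_nhdsWithin] with η (hη : 0 ≤ η)
      filter_upwards [ae_restrict_mem measurableSet_Ioi] with v hv
      exact norm_exp_mul_exp_rpow_le (by rw [Complex.re_ofReal_mul]; positivity) hv
    · exact Continuous.continuousWithinAt (by fun_prop)
  have h' := (h.tendsto).const_mul B
  have h0 := expPowIntegral_zero κ hB
  simp only [expPowIntegral, zero_mul] at h0
  simp only [Complex.ofReal_zero, zero_mul] at h'
  rwa [h0] at h'

/-! ### Arguments of the denominators -/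

/-- In the right half-plane `arg` is the arcsine of `im / norm`; the shift keeps `im` and does not
decrease the norm. -/
lemma abs_arg_ofReal_add_le {a : ℝ} (ha : 0 ≤ a) {z : ℂ} (hz : 0 < z.re) :
    |(a + z).arg| ≤ |z.arg| := by
  have hn : ‖z‖ ≤ ‖(a : ℂ) + z‖ := by
    refine abs_le_of_sq_le_sq' ?_ (norm_nonneg _) |>.2
    rw [Complex.sq_norm, Complex.sq_norm, Complex.normSq_apply, Complex.normSq_apply]
    simp
    nlinarith
  have hz0 : 0 < ‖z‖ := norm_pos_iff.2 (by rintro rfl; simp at hz)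
  have habs : ∀ t : ℝ, |Real.arcsin t| = Real.arcsin |t| := fun t => by
    rcases le_total 0 t with h | h
    · rw [abs_of_nonneg h, abs_of_nonneg (Real.arcsin_nonneg.2 h)]
    · rw [abs_of_nonpos h, abs_of_nonpos (Real.arcsin_nonpos.2 h), Real.arcsin_neg]
  rw [Complex.arg_of_re_nonneg (x := a + z) (by simp; linarith), Complex.arg_of_re_nonneg hz.le,
    habs, habs]
  refine Real.monotone_arcsin ?_
  rw [abs_div, abs_div, abs_of_pos hz0, abs_of_pos (hz0.trans_le hn)]
  simp only [Complex.add_im, Complex.ofReal_im, zero_add]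
  gcongr

lemma arg_cpow_ofReal {s : ℂ} {p : ℝ} (hs : s ≠ 0) (hp : |p * s.arg| < Real.pi) :
    (s ^ (p : ℂ)).arg = p * s.arg := by
  have him : (Complex.log s * (p : ℂ)).im = p * s.arg := by
    rw [Complex.im_mul_ofReal, Complex.log_im, mul_comm]
  have hp' := abs_lt.1 hp
  rw [Complex.cpow_def_of_ne_zero hs, ← Complex.log_im,
    Complex.log_exp (by rw [him]; exact hp'.1) (by rw [him]; exact hp'.2.le), him]

lemma ofReal_add_mul_cpow_re_pos_and_arg {s : ℂ} {p a om : ℝ} (hs : 0 < s.re) (hp0 : 0 < p)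
    (hp1 : p ≤ 1) (ha : 0 < a) (hom : 0 ≤ om) :
    0 < ((a : ℂ) + om * s ^ (p : ℂ)).re ∧ |((a : ℂ) + om * s ^ (p : ℂ)).arg| ≤ p * |s.arg| := by
  have hs0 : s ≠ 0 := by rintro rfl; simp at hs
  have harg : |s.arg| < Real.pi / 2 := Complex.abs_arg_lt_pi_div_two_iff.2 (Or.inl hs)
  have hps : |p * s.arg| < Real.pi / 2 := by
    rw [abs_mul, abs_of_pos hp0]
    nlinarith [abs_nonneg s.arg]
  have hS := arg_cpow_ofReal hs0 (hps.trans (by linarith [Real.pi_pos]))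
  have hS0 : s ^ (p : ℂ) ≠ 0 := by
    rw [Complex.cpow_def_of_ne_zero hs0]; exact Complex.exp_ne_zero _
  have hSre : 0 < (s ^ (p : ℂ)).re :=
    (Complex.abs_arg_lt_pi_div_two_iff.1 (by rwa [hS])).resolve_right hS0
  refine ⟨?_, ?_⟩
  · rw [Complex.add_re, Complex.ofReal_re, Complex.re_ofReal_mul]
    positivity
  · rcases hom.eq_or_lt with rfl | hom
    · simp only [Complex.ofReal_zero, zero_mul, add_zero, Complex.arg_ofReal_of_nonneg ha.le,
        abs_zero]
      positivity
    · refine (abs_arg_ofReal_add_le ha.le (z := om * s ^ (p : ℂ)) ?_).trans_eq ?_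
      · rw [Complex.re_ofReal_mul]; positivity
      · rw [Complex.arg_real_mul _ hom, hS, abs_mul, abs_of_pos hp0]

/-- The factor `2/α` is what the exponent `α/2` in the argument of the H-function cancels. -/
lemma denom_re_pos_and_arg {α om : ℝ} {K r l : ℕ} {s : ℂ} (hα : 2 < α) (hom : 0 ≤ om)
    (hr : r ≤ 2 * K) (hs : 0 < s.re) :
    0 < (denom α om K r l s).re ∧ |(denom α om K r l s).arg| ≤ 2 / α * |s.arg| := by
  have hr' : (r : ℝ) ≤ 2 * K := by exact_mod_cast hr
  have hl : (0 : ℝ) ≤ l := l.cast_nonneg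
  have ha : 0 < (2 * (K : ℝ) - r + l + 1) * cellConst := by
    unfold cellConst
    nlinarith
  have h := ofReal_add_mul_cpow_re_pos_and_arg (p := 2 / α) hs (by positivity)
    ((div_le_one (by linarith)).2 hα.le) ha hom
  have hd : denom α om K r l s =
      (((2 * (K : ℝ) - r + l + 1) * cellConst : ℝ) : ℂ) + om * s ^ ((2 / α : ℝ) : ℂ) := by
    rw [denom]; push_cast; rfl
  rwa [hd]

lemma interfCoeff_nonneg {N : ℕ} {α P ρ : ℝ} (hα : 2 < α) (h : 0 ≤ ρ / P)
    (u : EuclideanSpace ℂ (Fin N)) : 0 ≤ interfCoeff α P ρ u := by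
  have : 0 < 1 - 2 / α := by
    rw [sub_pos, div_lt_one (by linarith)]
    exact hα
  have := Real.Gamma_pos_of_pos this
  unfold interfCoeff
  positivity

/-! ### Averaging over the ranked distance -/

lemma orderStatPDF_eq_sum {n i : ℕ} (hi : i < n) (b : ℝ) {x : ℝ} (hx : 0 ≤ x) :
    orderStatPDF n i b x = ((i + 1 : ℕ) : ℝ) * (n.choose (i + 1) : ℝ) *
      ∑ l ∈ Finset.range (i + 1), (-1 : ℝ) ^ l * (i.choose l : ℝ) *
        (2 * b * x * Real.exp (-(((n : ℝ) - i + l) * b) * x ^ 2)) := by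
  -- With `n = i + m + 1`, the `l`-th term carries `e^l` from the expansion, `e^m` from the survival
  -- factor and `e` from `F'`: the rate is `(m + 1 + l) b`.
  obtain ⟨m, rfl⟩ := Nat.exists_eq_add_of_lt hi
  set e := Real.exp (-b * x ^ 2) with he
  have hexp : ∀ l : ℕ, Real.exp (-((((i + m + 1 : ℕ) : ℝ) - i + l) * b) * x ^ 2) =
      e ^ l * e ^ m * e := fun l => by
    rw [he, ← Real.exp_nat_mul, ← Real.exp_nat_mul, ← Real.exp_add, ← Real.exp_add]
    congr 1
    push_cast
    ring
  have hchoose : ((i + m + 1 : ℕ) : ℝ) * ((i + m).choose i : ℝ) =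
      ((i + 1 : ℕ) : ℝ) * ((i + m + 1).choose (i + 1) : ℝ) := by
    have := Nat.add_one_mul_choose_eq (i + m) i
    rw [mul_comm ((i + 1 : ℕ) : ℝ)]
    exact_mod_cast this
  have hbin : (1 - e) ^ i = ∑ l ∈ Finset.range (i + 1), (-1 : ℝ) ^ l * (i.choose l : ℝ) * e ^ l := by
    rw [sub_eq_neg_add, add_pow]
    refine Finset.sum_congr rfl fun l _ => ?_
    rw [neg_pow, one_pow]
    ring
  rw [orderStatPDF, if_pos hx, derivative_bernsteinTail hi, ← hchoose]
  simp only [bernsteinPolynomial, Polynomial.eval_mul, Polynomial.eval_natCast,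
    Polynomial.eval_pow, Polynomial.eval_X, Polynomial.eval_sub, Polynomial.eval_one, hexp]
  rw [← he, hbin, show i + m + 1 - 1 = i + m by omega, show i + m - i = m by omega,
    show (1 : ℝ) - (1 - e) = e by ring]
  simp only [Finset.mul_sum, Finset.sum_mul]
  refine Finset.sum_congr rfl fun l _ => ?_
  ring

/-- The summands are shaped for the substitution `v = x²`, with `2x` as Jacobian. Passing to `x > 0`
loses nothing, as the density vanishes at `0`. -/
lemma orderStatPDF_smul_phiIntegrand {N K r : ℕ} (hr1 : 1 ≤ r) (hr2 : r ≤ 2 * K)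
    {α lam P ρ σ2 : ℝ} (u : EuclideanSpace ℂ (Fin N)) (s : ℂ) (x : ℝ) :
    orderStatPDF (2 * K) (r - 1) (cellConst * lam * Real.pi) x • phiIntegrand α lam P ρ σ2 u s x =
      (Set.Ioi (0 : ℝ)).indicator (fun x => ∑ l ∈ Finset.range r,
        ((r : ℂ) * ((2 * K).choose r : ℂ) * ((-1 : ℂ) ^ l * ((r - 1).choose l : ℂ)) *
          ((cellConst * lam * Real.pi : ℝ) : ℂ)) *
        ((2 * x ^ ((2 : ℝ) - 1)) •
          (fun v : ℝ => Complex.exp (-(((Real.pi * lam : ℝ) : ℂ) *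
              denom α (interfCoeff α P ρ u) K r l s * v)) *
            Complex.exp (-(((filteredNoise σ2 u / P : ℝ) : ℂ) * s * (v ^ (α / 2) : ℝ))))
          (x ^ (2 : ℝ)))) x := by
  obtain ⟨i, rfl⟩ := Nat.exists_eq_add_of_le' hr1
  rcases lt_trichotomy x 0 with hx | rfl | hx
  · rw [orderStatPDF, if_neg (not_le.2 hx), zero_smul, Set.indicator_of_notMem (by simpa using hx.le)]
  · simp [orderStatPDF]
  · rw [Set.indicator_of_mem (Set.mem_Ioi.2 hx), Nat.add_sub_cancel,
      orderStatPDF_eq_sum (by omega) _ hx.le, Finset.mul_sum, Finset.sum_smul]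
    refine Finset.sum_congr rfl fun l _ => ?_
    have hx2 : (x ^ 2) ^ (α / 2) = x ^ α := by
      rw [← Real.rpow_two, ← Real.rpow_mul hx.le]; congr 1; ring
    have hx1 : x ^ ((2 : ℝ) - 1) = x := by norm_num
    have hpl : filteredNoise σ2 u / (P * pathLoss α x) = filteredNoise σ2 u / P * x ^ α := by
      rw [pathLoss, Real.rpow_neg hx.le, ← div_div, div_inv_eq_mul]
    simp only [hx1, hx2, phiIntegrand, hpl, Complex.real_smul, ← Complex.exp_add, Real.rpow_two]
    push_cast
    rw [show ∀ a b c d f : ℂ, a * b * (c * (d * Complex.exp f)) = a * b * c * d * Complex.exp f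
      from fun a b c d f => by ring]
    rw [mul_assoc _ (Complex.exp _) (Complex.exp _), ← Complex.exp_add]
    rw [show ∀ a b c d e f : ℂ, a * b * c * d * (e * Complex.exp f) =
      a * b * c * d * e * Complex.exp f from fun a b c d e f => by ring]
    congr 1
    · ring
    · congr 1
      rw [denom]
      push_cast
      ring

/-- The coefficient `cλπ` meets the `1/(πλ · denom)` hidden in `expPowIntegral` and leaves `c /
denom`, so `λ` survives only inside `expPowIntegral`. Zero noise is allowed, as the limit needs. -/
lemma integral_phiIntegrand {N K r : ℕ} (hr1 : 1 ≤ r) (hr2 : r ≤ 2 * K)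
    {α lam P ρ σ2 : ℝ} (hα : 2 < α) (hlam : 0 < lam) (u : EuclideanSpace ℂ (Fin N)) {s : ℂ}
    (hs : 0 < s.re) (hom : 0 ≤ interfCoeff α P ρ u) (hη : 0 ≤ filteredNoise σ2 u / P) :
    Integrable (phiIntegrand α lam P ρ σ2 u s) (volume.withDensity fun x =>
        ENNReal.ofReal (orderStatPDF (2 * K) (r - 1) (cellConst * lam * Real.pi) x)) ∧
      ∫ x, phiIntegrand α lam P ρ σ2 u s x ∂(volume.withDensity fun x =>
          ENNReal.ofReal (orderStatPDF (2 * K) (r - 1) (cellConst * lam * Real.pi) x)) =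
        (cellConst : ℂ) * r * ((2 * K).choose r : ℂ) *
          ∑ l ∈ Finset.range r, (-1 : ℂ) ^ l * ((r - 1).choose l : ℂ) *
            expPowIntegral (α / 2) (((filteredNoise σ2 u / P : ℝ) : ℂ) * s)
              (((Real.pi * lam : ℝ) : ℂ) * denom α (interfCoeff α P ρ u) K r l s) /
            denom α (interfCoeff α P ρ u) K r l s := by
  have hb : 0 < cellConst * lam * Real.pi := by
    have := Real.pi_pos
    unfold cellConst
    positivity
  have hpl : 0 < Real.pi * lam := by positivity
  have hnn : ∀ x, 0 ≤ orderStatPDF (2 * K) (r - 1) (cellConst * lam * Real.pi) x := fun x => by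
    rw [orderStatPDF]
    split_ifs with hx
    · have h1 : Real.exp (-(cellConst * lam * Real.pi) * x ^ 2) ≤ 1 :=
        Real.exp_le_one_iff.2 (by nlinarith [sq_nonneg x])
      have := bernsteinTail_derivative_eval_nonneg (n := 2 * K) (i := r - 1) (by omega)
        (p := 1 - Real.exp (-(cellConst * lam * Real.pi) * x ^ 2))
        ⟨by linarith, by linarith [Real.exp_pos (-(cellConst * lam * Real.pi) * x ^ 2)]⟩
      positivity
    · exact le_rfl
  have hmeas : Measurable fun x =>
      ENNReal.ofReal (orderStatPDF (2 * K) (r - 1) (cellConst * lam * Real.pi) x) := by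
    refine Measurable.ennreal_ofReal (Measurable.ite measurableSet_Ici ?_ measurable_const)
    exact Continuous.measurable (by fun_prop)
  have hfin : ∀ᵐ x, ENNReal.ofReal
      (orderStatPDF (2 * K) (r - 1) (cellConst * lam * Real.pi) x) < ⊤ := by simp
  have hB : ∀ l, 0 < (((Real.pi * lam : ℝ) : ℂ) * denom α (interfCoeff α P ρ u) K r l s).re :=
    fun l => by
      rw [Complex.re_ofReal_mul]
      exact mul_pos hpl (denom_re_pos_and_arg hα hom hr2 hs).1
  have hw : 0 ≤ (((filteredNoise σ2 u / P : ℝ) : ℂ) * s).re := by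
    rw [Complex.re_ofReal_mul]; positivity
  have hint := fun l => integrableOn_exp_mul_exp_rpow (α / 2) hw (hB l)
  have hint2 := fun l => (integrableOn_Ioi_comp_rpow_iff _ (two_ne_zero' ℝ)).2 (hint l)
  simp only [abs_two] at hint2
  rw [integrable_withDensity_iff_integrable_smul' hmeas hfin,
    integral_withDensity_eq_integral_toReal_smul hmeas hfin]
  simp only [ENNReal.toReal_ofReal (hnn _), orderStatPDF_smul_phiIntegrand hr1 hr2]
  refine ⟨?_, ?_⟩
  · rw [integrable_indicator_iff measurableSet_Ioi]
    exact integrable_finsetSum _ fun l _ => (hint2 l).const_mul _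
  · rw [integral_indicator measurableSet_Ioi,
      integral_finsetSum _ fun l _ => (hint2 l).const_mul _, Finset.mul_sum]
    refine Finset.sum_congr rfl fun l _ => ?_
    have hsub := integral_comp_rpow_Ioi_of_pos (g := fun v : ℝ =>
      Complex.exp (-(((Real.pi * lam : ℝ) : ℂ) * denom α (interfCoeff α P ρ u) K r l s * v)) *
        Complex.exp (-(((filteredNoise σ2 u / P : ℝ) : ℂ) * s * (v ^ (α / 2) : ℝ)))) two_pos
    rw [integral_const_mul, hsub, expPowIntegral]
    have hd : denom α (interfCoeff α P ρ u) K r l s ≠ 0 := by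
      intro h
      have := hB l
      rw [h] at this
      simp at this
    generalize (∫ y : ℝ in Set.Ioi 0, _ : ℂ) = J
    field_simp
    push_cast
    ring

end SmallCell

/-! ### The main theorem -/

theorem theorem2 {Ω : Type*} [MeasurableSpace Ω] (μ : Measure Ω) [IsProbabilityMeasure μ]
    (K r N : ℕ) (hr1 : 1 ≤ r) (hr2 : r ≤ 2 * K)
    (α lam P ρ σ2 : ℝ) (hα : 2 < α) (hlam : 0 < lam) (hP : 0 < P) (hρ : 0 ≤ ρ) (hσ : 0 < σ2)
    (u : EuclideanSpace ℂ (Fin N)) (hu : u ≠ 0)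
    -- the distances of the `2K` users from their serving station, i.i.d. with density `f_d`
    (D : Fin (2 * K) → Ω → ℝ) (hD : ∀ i, HasLaw (D i) (SmallCell.distLaw lam) μ)
    (hindep : iIndepFun D μ)
    -- the distance of the user of rank `r` in increasing order
    (d : Ω → ℝ) (hd : ∀ x, d x = SmallCell.orderStat (fun i => D i x) ⟨r - 1, by omega⟩)
    (s : ℂ) (hs : 0 < s.re) :
    Integrable (fun x => SmallCell.phiIntegrand α lam P ρ σ2 u s (d x)) μ ∧
    (∀ l ∈ Finset.range r,
      SmallCell.IsFoxHValue 1 1 ![((0 : ℝ), α / 2)] ![((0 : ℝ), (1 : ℝ))]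
        (SmallCell.foxArg α lam P ρ σ2 u K r l s)
        (SmallCell.foxH 1 1 ![((0 : ℝ), α / 2)] ![((0 : ℝ), (1 : ℝ))]
          (SmallCell.foxArg α lam P ρ σ2 u K r l s))) ∧
    SmallCell.phi μ d α lam P ρ σ2 u s =
      (SmallCell.cellConst : ℂ) * r * ((2 * K).choose r : ℂ) *
        ∑ l ∈ Finset.range r, (-1 : ℂ) ^ l * ((r - 1).choose l : ℂ) *
          SmallCell.foxH 1 1 ![((0 : ℝ), α / 2)] ![((0 : ℝ), (1 : ℝ))]
            (SmallCell.foxArg α lam P ρ σ2 u K r l s) /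
          SmallCell.denom α (SmallCell.interfCoeff α P ρ u) K r l s ∧
    -- `σ²/P → 0` in any way, with `ρ_I/P` (hence `ω`) kept fixed
    (∀ (ι : Type) (F : Filter ι) (P' ρ' σ2' : ι → ℝ), (∀ i, 0 < P' i) → (∀ i, 0 ≤ σ2' i) →
      (∀ i, ρ' i / P' i = ρ / P) → Tendsto (fun i => σ2' i / P' i) F (𝓝 0) →
      Tendsto (fun i => SmallCell.phi μ d α lam (P' i) (ρ' i) (σ2' i) u s) F
        (𝓝 ((SmallCell.cellConst : ℂ) * r * ((2 * K).choose r : ℂ) *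
          ∑ l ∈ Finset.range r, (-1 : ℂ) ^ l * ((r - 1).choose l : ℂ) /
            SmallCell.denom α (SmallCell.interfCoeff α P ρ u) K r l s))) := by
  obtain ⟨i, rfl⟩ := Nat.exists_eq_add_of_le' hr1
  have hlaw := SmallCell.hasLaw_orderStat hlam hD hindep ⟨i + 1 - 1, by omega⟩
  rw [← funext hd] at hlaw
  have hom := SmallCell.interfCoeff_nonneg hα (div_nonneg hρ hP.le) u
  have hη : 0 < SmallCell.filteredNoise σ2 u / P := by
    have := norm_pos_iff.2 hu
    unfold SmallCell.filteredNoise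
    positivity
  have hw : 0 < (((SmallCell.filteredNoise σ2 u / P : ℝ) : ℂ) * s).re := by
    rw [Complex.re_ofReal_mul]
    positivity
  have hpl : 0 < Real.pi * lam := by positivity
  have hB : ∀ l, 0 < (((Real.pi * lam : ℝ) : ℂ) *
      SmallCell.denom α (SmallCell.interfCoeff α P ρ u) K (i + 1) l s).re := fun l => by
    rw [Complex.re_ofReal_mul]
    exact mul_pos hpl (SmallCell.denom_re_pos_and_arg hα hom hr2 hs).1
  have hfox : ∀ l, SmallCell.IsFoxHValue 1 1 ![((0 : ℝ), α / 2)] ![((0 : ℝ), (1 : ℝ))]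
      (SmallCell.foxArg α lam P ρ σ2 u K (i + 1) l s)
      (SmallCell.expPowIntegral (α / 2) (((SmallCell.filteredNoise σ2 u / P : ℝ) : ℂ) * s)
        (((Real.pi * lam : ℝ) : ℂ) *
          SmallCell.denom α (SmallCell.interfCoeff α P ρ u) K (i + 1) l s)) := fun l => by
    refine SmallCell.isFoxHValue_expPowIntegral (by linarith) hw (hB l) ?_
    have hα2 : 0 < α / 2 := by linarith
    rw [Complex.arg_real_mul _ hpl, abs_mul, abs_of_pos hα2]
    calc α / 2 * |(SmallCell.denom α (SmallCell.interfCoeff α P ρ u) K (i + 1) l s).arg|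
        ≤ α / 2 * (2 / α * |s.arg|) := by
          gcongr
          exact (SmallCell.denom_re_pos_and_arg hα hom hr2 hs).2
      _ = |s.arg| := by
          have : α ≠ 0 := by linarith
          field_simp
      _ < Real.pi / 2 := Complex.abs_arg_lt_pi_div_two_iff.2 (Or.inl hs)
  -- Kept in integral form and for arbitrary parameters: the H-function evaluation needs positive
  -- noise, whereas the family in the limit may have zero noise.
  have hphi : ∀ {P' ρ' σ' : ℝ}, 0 ≤ SmallCell.interfCoeff α P' ρ' u →
      0 ≤ SmallCell.filteredNoise σ' u / P' →
      Integrable (fun x => SmallCell.phiIntegrand α lam P' ρ' σ' u s (d x)) μ ∧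
      SmallCell.phi μ d α lam P' ρ' σ' u s = (SmallCell.cellConst : ℂ) * (i + 1 : ℕ) *
        ((2 * K).choose (i + 1) : ℂ) * ∑ l ∈ Finset.range (i + 1),
          (-1 : ℂ) ^ l * ((i + 1 - 1).choose l : ℂ) *
            SmallCell.expPowIntegral (α / 2) (((SmallCell.filteredNoise σ' u / P' : ℝ) : ℂ) * s)
              (((Real.pi * lam : ℝ) : ℂ) *
                SmallCell.denom α (SmallCell.interfCoeff α P' ρ' u) K (i + 1) l s) /
            SmallCell.denom α (SmallCell.interfCoeff α P' ρ' u) K (i + 1) l s := by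
    intro P' ρ' σ' hom' hη'
    obtain ⟨h1, h2⟩ := SmallCell.integral_phiIntegrand (Nat.le_add_left 1 i) hr2 hα hlam u hs
      hom' hη'
    have h3 := hlaw.map_eq
    rw [← h3] at h1 h2
    refine ⟨h1.comp_aemeasurable hlaw.aemeasurable, ?_⟩
    rw [← h2, integral_map hlaw.aemeasurable h1.aestronglyMeasurable]
    rfl
  refine ⟨(hphi hom hη.le).1, fun l _ => ?_, ?_, ?_⟩
  · rw [(hfox l).foxH_eq]
    exact hfox l
  · simp only [(hfox _).foxH_eq]
    exact (hphi hom hη.le).2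
  · intro ι F P' ρ' σ2' hP' hσ' hratio hlim
    have hom' : ∀ j, SmallCell.interfCoeff α (P' j) (ρ' j) u = SmallCell.interfCoeff α P ρ u :=
      fun j => by simp only [SmallCell.interfCoeff, hratio j]
    have hη0 : ∀ j, 0 ≤ SmallCell.filteredNoise (σ2' j) u / P' j := fun j => by
      have := hP' j
      have := hσ' j
      unfold SmallCell.filteredNoise
      positivity
    have hηlim : Tendsto (fun j => SmallCell.filteredNoise (σ2' j) u / P' j) F (𝓝[≥] 0) := by
      refine tendsto_nhdsWithin_iff.2 ⟨?_, Eventually.of_forall hη0⟩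
      have := hlim.mul_const (‖u‖ ^ 2)
      rw [zero_mul] at this
      refine this.congr fun j => ?_
      rw [SmallCell.filteredNoise]
      ring
    have hval := fun j => (hphi (by rw [hom' j]; exact hom) (hη0 j)).2
    simp only [hval, hom']
    refine Tendsto.const_mul _ (tendsto_finsetSum _ fun l _ => ?_)
    have := (SmallCell.tendsto_expPowIntegral (α / 2) hs (hB l)).comp hηlim
    simpa using (this.const_mul ((-1 : ℂ) ^ l * ((i + 1 - 1).choose l : ℂ))).div_const
      (SmallCell.denom α (SmallCell.interfCoeff α P ρ u) K (i + 1) l s)
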